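/- Let $D$ be a Prüfer domain (an integral domain such that $D_P$ is a valuation domain for every prime $P$) with quotient field $K$. A set $X\subseteq\mathrm{Spec}(D)$ is a \emph{splitting set} if it is closed under specialization ($P\in X$ and $P\subseteq P'$ imply $P'\in X$) and $\mathrm{Spec}(D)\setminus X$ is compact in the Zariski topology; it is \emph{discrete} if $P\neq P^2$ for every $P\in X$. For an overring $T$ of $D$ (a ring with $D\subseteq T\subseteq K$) put $XT:=\{PT\mid P\in X,\ PT\neq T\}\subseteq\mathrm{Spec}(T)$. For a domain $T$ with quotient field $K$ and a set $Z\subseteq\mathrm{Spec}(T)$, let $\mathrm{Inv}_Z(T)$ be the set of invertible fractional ideals $I$ of $T$ whose support $\{P\in\mathrm{Spec}(T)\mid IT_P\neq T_P\}$ is contained in $Z$, and let $\mathrm{Crit}_Z(T)$ be the set of all $M\in Z$ such that there is no radical ideal $I$ of $T$ with $I\in\mathrm{Inv}_Z(T)$ and $I\subseteq M$. Let $X\subseteq\mathrm{Max}(D)$ be a discrete splitting set of $D$. Define, by transfinite recursion on the ordinal $\alpha$, subsets $\mathrm{Crit}_X^\alpha(D)$ of $X$ and overrings $T_\alpha$ of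 $D$ as follows: \begin{itemize} \item $\mathrm{Crit}_X^0(D):=X$; \item $\mathrm{Crit}_X^{\gamma+1}(D):=\{P\in X\mid PT_\gamma\in\mathrm{Crit}_{XT_\gamma}(T_\gamma)\}$; \item $\mathrm{Crit}_X^{\alpha}(D):=\bigcap_{\gamma<\alpha}\mathrm{Crit}_X^\gamma(D)$ if $\alpha$ is a limit ordinal; \item $T_\alpha:=\bigcap\{D_P\mid P\in\mathrm{Crit}_X^\alpha(D)\cup(\mathrm{Spec}(D)\setminus X)\}$ for every ordinal $\alpha$. \end{itemize} Then there is an ordinal number $\beta$ such that $\mathrm{Crit}_X^\beta(D)=\emptyset$. Consequently the \emph{SP-rank} of $D$ with respect to $X$, defined as the minimal ordinal $\alpha$ with $\mathrm{Crit}_X^\alpha(D)=\emptyset$, is well defined: it is the least element of the class of all ordinals $\alpha$ such that $\mathrm{Crit}_X^\alpha(D)=\emptyset$. -/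

import Mathlib

universe u v

open scoped nonZeroDivisors

noncomputable section

namespace CriticalSequence

section Basic

variable {D : Type u} [CommRing D]

/-- A Prüfer domain: an integral domain all of whose localizations at prime ideals are valuation
domains. -/
def IsPruferDomain (D : Type u) [CommRing D] [IsDomain D] : Prop :=
  ∀ P : PrimeSpectrum D, ValuationRing (Localization.AtPrime P.asIdeal)

/-- A splitting set: a set of primes closed under specialization whose complement in the spectrum
is compact in the Zariski topology (equivalently, an up-closed set that is open in the inverse
topology). -/
def IsSplittingSet (X : Set (PrimeSpectrum D)) : Prop :=
  (∀ P ∈ X, ∀ P' : PrimeSpectrum D, P.asIdeal ≤ P'.asIdeal → P' ∈ X) ∧ IsCompact Xᶜ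

/-- A splitting set is discrete if none of its members is idempotent. -/
def IsDiscreteSplittingSet (X : Set (PrimeSpectrum D)) : Prop :=
  IsSplittingSet X ∧ ∀ P ∈ X, P.asIdeal ^ 2 ≠ P.asIdeal

/-- The maximal space of `D`, as a subset of its spectrum. -/
def maxSpec (D : Type u) [CommRing D] : Set (PrimeSpectrum D) :=
  {P | P.asIdeal.IsMaximal}

/-- The extension `XT = {PT | P ∈ X, PT ≠ T}` to a `D`-algebra `T`, as a set of primes of `T`.
It is used when `T` is an overring of a Prüfer domain `D`, where each `PT` is either `T` or a
prime ideal of `T`. -/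
def extendSet (X : Set (PrimeSpectrum D)) (T : Type v) [CommRing T] [Algebra D T] :
    Set (PrimeSpectrum T) :=
  {Q | ∃ P ∈ X, Q.asIdeal = P.asIdeal.map (algebraMap D T)}

end Basic

section FractionField

variable {D : Type u} [CommRing D] [IsDomain D]
variable (K : Type v) [Field K] [Algebra D K] [IsFractionRing D K]

/-- The localization `D_P`, as an overring of `D` inside the quotient field `K`. -/
def locAt (P : PrimeSpectrum D) : Subalgebra D K :=
  Localization.subalgebra.ofField K P.asIdeal.primeCompl P.asIdeal.primeCompl_le_nonZeroDivisors

/-- The support of a fractional ideal: the primes `P` with `I D_P ≠ D_P`. -/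
def supp (I : FractionalIdeal D⁰ K) : Set (PrimeSpectrum D) :=
  {P | (I : Submodule D K) * Subalgebra.toSubmodule (locAt K P) ≠
    Subalgebra.toSubmodule (locAt K P)}

/-- The set `Inv_X(D)` of the invertible fractional ideals of `D` with support inside `X`. -/
def InvX (X : Set (PrimeSpectrum D)) : Set (FractionalIdeal D⁰ K) :=
  {I | IsUnit I ∧ supp K I ⊆ X}

/-- `Crit_X(D)`: the `M ∈ X` such that no radical ideal belonging to `Inv_X(D)` is contained
in `M`. -/
def Crit (X : Set (PrimeSpectrum D)) : Set (PrimeSpectrum D) :=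
  {M | M ∈ X ∧ ¬ ∃ I : Ideal D,
    I.IsRadical ∧ (I : FractionalIdeal D⁰ K) ∈ InvX K X ∧ I ≤ M.asIdeal}

/-- The overring `⋂ {D_P | P ∈ C ∪ (Spec(D) \ X)}` of `D`. -/
def overringOf (X C : Set (PrimeSpectrum D)) : Subalgebra D K :=
  ⨅ P ∈ C ∪ Xᶜ, locAt K P

/-- One step of the critical sequence: with `T = ⋂ {D_P | P ∈ C ∪ (Spec(D) \ X)}`, this is
`{P ∈ X | PT ∈ Crit_{XT}(T)}`. -/
def critStep (X C : Set (PrimeSpectrum D)) : Set (PrimeSpectrum D) :=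
  {P | P ∈ X ∧ ∃ Q ∈ Crit K (extendSet X (overringOf K X C)),
    Q.asIdeal = P.asIdeal.map (algebraMap D (overringOf K X C))}

/-- The critical sequence `Crit_X^α(D)`, by transfinite recursion on `α`. -/
def critSeq (X : Set (PrimeSpectrum D)) (α : Ordinal.{u}) : Set (PrimeSpectrum D) :=
  Ordinal.limitRecOn (motive := fun _ => Set (PrimeSpectrum D)) α X
    (fun _ C => critStep K X C)
    (fun α _ C => ⋂ (γ : Ordinal.{u}) (h : γ < α), C γ h)

/-- The overring `T_α` attached to the `α`-th term of the critical sequence. -/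
def critOverring (X : Set (PrimeSpectrum D)) (α : Ordinal.{u}) : Subalgebra D K :=
  overringOf K X (critSeq K X α)

/-- The SP-rank of `D` with respect to `X`: the minimal ordinal at which the critical sequence is
empty. -/
def spRank (X : Set (PrimeSpectrum D)) : Ordinal.{u} :=
  sInf {α | critSeq K X α = ∅}

/-! The recursive equations of the critical sequence. -/

theorem critSeq_zero (X : Set (PrimeSpectrum D)) : critSeq K X 0 = X := by
  simp [critSeq]

theorem critSeq_add_one (X : Set (PrimeSpectrum D)) (γ : Ordinal.{u}) :
    critSeq K X (γ + 1) =
      {P | P ∈ X ∧ ∃ Q ∈ Crit K (extendSet X (critOverring K X γ)),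
        Q.asIdeal = P.asIdeal.map (algebraMap D (critOverring K X γ))} := by
  rw [critSeq, Ordinal.limitRecOn_add_one]
  rfl

theorem critSeq_limit (X : Set (PrimeSpectrum D)) (α : Ordinal.{u}) (h : Order.IsSuccLimit α) :
    critSeq K X α = ⋂ (γ : Ordinal.{u}) (_ : γ < α), critSeq K X γ := by
  rw [critSeq, Ordinal.limitRecOn_limit _ _ _ _ h]
  rfl

end FractionField

end CriticalSequence

end

/-!
Each step of the critical sequence removes at least one prime as long as a prime is left, so the
sequence reaches the empty set, because the ordinals do not embed into the spectrum of `D`.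

The reason that a step removes a prime is `LocallyComparable.exists_fg_isRadical`: in a Prüfer
domain, let `J` be a proper finitely generated ideal such that all primes over `J` are maximal and
not idempotent. Then each prime `Q` over `J` satisfies `J ⊄ Q ^ n` for some `n`. A category
argument on the zero locus of `J`, carried out in
`exists_fg_forall_not_le_pow` with an increasing sequence of finitely generated ideals, makes the
exponent uniform on a smaller zero locus; for the least possible exponent one finds a proper
finitely generated ideal above `J` that is not contained in `Q ^ 2` for any maximal `Q` over it, and
such an ideal is radical.

To apply this to the overring `T` of a term `C` of the sequence, one has to know that the primes of
`X` which survive in `T` are those of `C` (`mem_of_map_overringOf_ne_top`). This needs `X \ C` to be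
open in the inverse topology, a property that is carried along the sequence
(`isInverseOpen_diff_critStep`).

The passage between `D` and its overrings rests on the predicate `SplitsFractions`, an elementwise
form of the Prüfer condition that is plainly inherited by overrings and shows at once that
every ideal of an overring is extended from `D`.
-/

namespace CriticalSequence

/-- Elementwise form of "every localization of `R` at a prime is a chain ring": of two elements,
one divides the other after multiplication by some `s` outside the prime. -/
def LocallyComparable (R : Type*) [CommRing R] : Prop :=
  ∀ Q : Ideal R, Q.IsPrime → ∀ a b : R, ∃ s ∉ Q, a ∣ s * b ∨ b ∣ s * a

/-- Every `t : A` admits `c, d : D` with `c + t * d = 1` and both `t * c` and `t * d = 1 - c` in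
the image of `D`; so the ideal of denominators of `t` becomes the unit ideal in `A`. For `A` the
quotient field of a domain `D` this says that `D` is Prüfer. The condition involves only one
element of `A` at a time, hence it passes to all intermediate rings. -/
def SplitsFractions (D A : Type*) [CommRing D] [CommRing A] [Algebra D A] : Prop :=
  ∀ t : A, ∃ c d e : D, t * algebraMap D A c = algebraMap D A e ∧
    algebraMap D A c + t * algebraMap D A d = 1

/-! ### Radical ideals in locally comparable rings -/

section LocallyComparable

variable {R : Type*} [CommRing R]

/-- The square of a maximal ideal `Q` is `Q`-primary. -/
theorem mem_sq_of_mul_mem {Q : Ideal R} (hQ : Q.IsMaximal) {s b : R} (hs : s ∉ Q)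
    (h : s * b ∈ Q ^ 2) : b ∈ Q ^ 2 := by
  have hb : b ∈ Q := (hQ.isPrime.mem_or_mem (Ideal.pow_le_self two_ne_zero h)).resolve_left hs
  obtain ⟨y, i, hi, hyi⟩ := hQ.exists_inv hs
  have : b = y * (s * b) + i * b := by linear_combination -b * hyi
  rw [this]
  refine add_mem (Ideal.mul_mem_left _ _ h) ?_
  rw [pow_two]
  exact Ideal.mul_mem_mul hi hb

/-- An element of `Q \ Q ^ 2` generates `Q` locally at `Q`. -/
theorem LocallyComparable.exists_dvd (hR : LocallyComparable R) {Q : Ideal R} (hQ : Q.IsMaximal)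
    {b x : R} (hb : b ∉ Q ^ 2) (hx : x ∈ Q) : ∃ s ∉ Q, b ∣ s * x := by
  obtain ⟨s, hs, ⟨t, ht⟩ | h⟩ := hR Q hQ.isPrime x b
  · refine ⟨t, fun htQ => hb (mem_sq_of_mul_mem hQ hs ?_), s, by rw [mul_comm t, ← ht, mul_comm]⟩
    rw [ht, pow_two]
    exact Ideal.mul_mem_mul hx htQ
  · exact ⟨s, hs, h⟩

/-- If `J ⊄ Q ^ 2`, then `J` and `Q` agree locally at `Q`; when this holds for all maximal `Q ⊇ J`,
the ideal `J` is the intersection of these `Q`. -/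
theorem LocallyComparable.isRadical (hR : LocallyComparable R) {J : Ideal R}
    (hJ : ∀ Q : Ideal R, Q.IsMaximal → J ≤ Q → ¬ J ≤ Q ^ 2) : J.IsRadical := by
  intro x hx
  by_contra hxJ
  have hne : J.colon {x} ≠ ⊤ := by
    rw [Ne, Ideal.eq_top_iff_one, Submodule.mem_colon_singleton]
    simpa using hxJ
  obtain ⟨Q, hQ, hle⟩ := Ideal.exists_le_maximal _ hne
  have hJQ : J ≤ Q := fun j hj => hle (Submodule.mem_colon_singleton.2 (by
    simpa using Ideal.mul_mem_right x J hj))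
  have hxQ : x ∈ Q := hQ.isPrime.radical_le_iff.2 hJQ hx
  obtain ⟨b, hb, hb2⟩ := SetLike.not_le_iff_exists.1 (hJ Q hQ hJQ)
  obtain ⟨s, hs, t, ht⟩ := hR.exists_dvd hQ hb2 hxQ
  refine hs (hle (Submodule.mem_colon_singleton.2 ?_))
  rw [smul_eq_mul, ht]
  exact Ideal.mul_mem_right _ _ hb

/-- If `J` were contained in every power of `Q`, then for `π ∈ Q \ Q ^ 2` it would be disjoint from
the multiplicative set generated by `π` and the complement of `Q`, and so lie in a prime strictly
below `Q`. -/
theorem LocallyComparable.exists_not_le_pow [IsDomain R] (hR : LocallyComparable R)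
    {J Q : Ideal R} (hJ : ∀ p : Ideal R, p.IsPrime → J ≤ p → p.IsMaximal) (hQ : Q.IsMaximal)
    (hQ2 : Q ^ 2 ≠ Q) : ∃ n, ¬ J ≤ Q ^ n := by
  by_contra! hle
  obtain ⟨π, hπ, hπ2⟩ := SetLike.not_le_iff_exists.1
    (fun h => hQ2 (le_antisymm (Ideal.pow_le_self two_ne_zero) h))
  have hπ0 : π ≠ 0 := fun h => hπ2 (h ▸ zero_mem _)
  have key : ∀ n : ℕ, ∀ x ∈ Q ^ n, ∃ s ∉ Q, π ^ n ∣ s * x := by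
    intro n
    induction n with
    | zero => exact fun x _ => ⟨1, fun h => hQ.ne_top ((Ideal.eq_top_iff_one _).2 h), by simp⟩
    | succ n ih =>
      intro x hx
      rw [pow_succ] at hx
      induction hx using Submodule.mul_induction_on' with
      | mem_mul_mem m hm q hq =>
        obtain ⟨s, hs, h⟩ := ih m hm
        obtain ⟨t, ht, h'⟩ := hR.exists_dvd hQ hπ2 hq
        refine ⟨s * t, fun hst => (hQ.isPrime.mem_or_mem hst).elim hs ht, ?_⟩
        rw [pow_succ, show s * t * (m * q) = (s * m) * (t * q) by ring]
        exact mul_dvd_mul h h'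
      | add y _ z _ hy hz =>
        obtain ⟨s, hs, h⟩ := hy
        obtain ⟨t, ht, h'⟩ := hz
        refine ⟨s * t, fun hst => (hQ.isPrime.mem_or_mem hst).elim hs ht, ?_⟩
        rw [show s * t * (y + z) = t * (s * y) + s * (t * z) by ring]
        exact dvd_add (h.mul_left _) (h'.mul_left _)
  have := hQ.isPrime
  -- `s * π ^ n ∈ J ≤ Q ^ (n + 1)` would make `π` divide an element outside `Q`.
  obtain ⟨p, hp, hJp, hdisj⟩ := Ideal.exists_le_prime_disjoint J
    (Q.primeCompl ⊔ Submonoid.powers π) (by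
      rw [Set.disjoint_left]
      intro x hxJ hxS
      obtain ⟨s, hs, _, ⟨n, rfl⟩, rfl⟩ := Submonoid.mem_sup.1 hxS
      obtain ⟨t, ht, h⟩ := key (n + 1) _ (hle (n + 1) hxJ)
      rw [pow_succ', ← mul_assoc] at h
      have h' := (mul_dvd_mul_iff_right (pow_ne_zero n hπ0)).1 h
      exact (hQ.isPrime.mem_or_mem (Q.mem_of_dvd h' hπ)).elim ht hs)
  rw [Set.disjoint_left] at hdisj
  have hpQ : p ≤ Q := fun x hx => by
    by_contra hxQ
    exact hdisj hx (Submonoid.mem_sup_left (show x ∈ Q.primeCompl from hxQ))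
  have := (hJ p hp hJp).eq_of_le hQ.ne_top hpQ
  exact hdisj (this ▸ hπ : π ∈ p) (Submonoid.mem_sup_right (Submonoid.mem_powers π))

theorem exists_fg_mem_pow {Q : Ideal R} (n : ℕ) {x : R} (hx : x ∈ Q ^ n) :
    ∃ B : Ideal R, B.FG ∧ B ≤ Q ∧ x ∈ B ^ n := by
  induction n generalizing x with
  | zero => exact ⟨⊥, Submodule.fg_bot, bot_le, by simp⟩
  | succ n ih =>
    rw [pow_succ] at hx
    induction hx using Submodule.mul_induction_on' with
    | mem_mul_mem m hm q hq =>
      obtain ⟨B, hB, hBQ, hmB⟩ := ih hm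
      refine ⟨B ⊔ Ideal.span {q}, Submodule.FG.sup hB (Submodule.fg_span_singleton q),
        sup_le hBQ ((Ideal.span_singleton_le_iff_mem _).2 hq), ?_⟩
      rw [pow_succ]
      exact Ideal.mul_mem_mul (Ideal.pow_right_mono le_sup_left n hmB)
        (Ideal.mem_sup_right (Ideal.mem_span_singleton_self q))
    | add y _ z _ hy hz =>
      obtain ⟨B, hB, hBQ, hyB⟩ := hy
      obtain ⟨C, hC, hCQ, hzC⟩ := hz
      exact ⟨B ⊔ C, Submodule.FG.sup hB hC, sup_le hBQ hCQ,
        add_mem (Ideal.pow_right_mono le_sup_left _ hyB) (Ideal.pow_right_mono le_sup_right _ hzC)⟩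

theorem exists_fg_le_pow {J Q : Ideal R} (hJ : J.FG) (n : ℕ) (h : J ≤ Q ^ n) :
    ∃ B : Ideal R, B.FG ∧ B ≤ Q ∧ J ≤ B ^ n := by
  induction J, hJ using Submodule.fg_induction with
  | singleton x =>
    obtain ⟨B, hB, hBQ, hx⟩ := exists_fg_mem_pow n (h (Ideal.mem_span_singleton_self x))
    exact ⟨B, hB, hBQ, (Ideal.span_singleton_le_iff_mem _).2 hx⟩
  | sup J₁ J₂ _ _ h₁ h₂ =>
    obtain ⟨B, hB, hBQ, hyB⟩ := h₁ (le_sup_left.trans h)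
    obtain ⟨C, hC, hCQ, hzC⟩ := h₂ (le_sup_right.trans h)
    exact ⟨B ⊔ C, Submodule.FG.sup hB hC, sup_le hBQ hCQ,
      sup_le (hyB.trans (Ideal.pow_right_mono le_sup_left _))
      (hzC.trans (Ideal.pow_right_mono le_sup_right _))⟩

/-- A replacement for the Baire category theorem on the zero locus of `J`: otherwise there would be
an increasing sequence of proper ideals whose `n`-th powers contain `J`, and a maximal ideal over
their union would contradict `h`. -/
theorem exists_fg_forall_not_le_pow {J : Ideal R} (hJ : J.FG) (hJ1 : J ≠ ⊤)
    (h : ∀ Q : Ideal R, Q.IsMaximal → ∃ n, ¬ J ≤ Q ^ n) :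
    ∃ n : ℕ, ∃ J' : Ideal R, J'.FG ∧ J ≤ J' ∧ J' ≠ ⊤ ∧
      ∀ B : Ideal R, B.FG → J' ≤ B → B ≠ ⊤ → ¬ J ≤ B ^ n := by
  by_contra! hcon
  let S := {B : Ideal R // B.FG ∧ J ≤ B ∧ B ≠ ⊤}
  have step : ∀ (n : ℕ) (A : S), ∃ B : S, A.1 ≤ B.1 ∧ J ≤ B.1 ^ n := fun n A => by
    obtain ⟨B, hB, hAB, hB1, hJB⟩ := hcon n A.1 A.2.1 A.2.2.1 A.2.2.2
    exact ⟨⟨B, hB, A.2.2.1.trans hAB, hB1⟩, hAB, hJB⟩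
  choose f hf hf' using step
  let a : ℕ → S := fun n => Nat.rec ⟨J, hJ, le_rfl, hJ1⟩ f n
  have ha : ∀ n, a (n + 1) = f n (a n) := fun n => rfl
  have hmono : Monotone fun n => (a n).1 := monotone_nat_of_le_succ fun n => hf n (a n)
  have htop : (⨆ n, (a n).1) ≠ ⊤ := by
    rw [Ne, Ideal.eq_top_iff_one, Submodule.mem_iSup_of_directed _ hmono.directed_le]
    rintro ⟨n, hn⟩
    exact (a n).2.2.2 ((Ideal.eq_top_iff_one _).2 hn)
  obtain ⟨Q, hQ, hle⟩ := Ideal.exists_le_maximal _ htop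
  obtain ⟨n, hn⟩ := h Q hQ
  exact hn ((hf' n (a n)).trans
    (Ideal.pow_right_mono ((le_iSup (fun n => (a n).1) (n + 1)).trans hle) n))

/-- A proper finitely generated ideal over which all primes are maximal and not idempotent lies in
a proper finitely generated radical ideal. Take the least `m + 1` as in
`exists_fg_forall_not_le_pow`, witnessed by `J'`, and a proper `B ⊇ J'` with `J ≤ B ^ m`. If `B`
were contained in `Q ^ 2`, then `J ≤ Q ^ (2 * m) ≤ Q ^ (m + 1)`, against the choice of `J'`. -/
theorem LocallyComparable.exists_fg_isRadical [IsDomain R] (hR : LocallyComparable R)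
    {J : Ideal R} (hJ : J.FG) (hJ1 : J ≠ ⊤)
    (hmax : ∀ p : Ideal R, p.IsPrime → J ≤ p → p.IsMaximal ∧ p ^ 2 ≠ p) :
    ∃ I : Ideal R, I.FG ∧ J ≤ I ∧ I ≠ ⊤ ∧ I.IsRadical := by
  classical
  have hex := exists_fg_forall_not_le_pow hJ hJ1 fun Q hQ => by
    by_cases hJQ : J ≤ Q
    · exact hR.exists_not_le_pow (fun p hp h => (hmax p hp h).1) hQ (hmax Q hQ.isPrime hJQ).2
    · exact ⟨1, by simpa using hJQ⟩
  obtain ⟨J', hJ', hJJ', hJ'1, hno⟩ := Nat.find_spec hex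
  have h2 : 2 ≤ Nat.find hex := by
    by_contra! hlt
    refine hno J' hJ' le_rfl hJ'1 ?_
    interval_cases Nat.find hex <;> simp [hJJ']
  -- `2 ≤ m + 1` is what makes `m + 1 ≤ 2 * m` below.
  obtain ⟨m, hm⟩ : ∃ m, Nat.find hex = m + 1 := ⟨Nat.find hex - 1, by omega⟩
  have hmin := Nat.find_min hex (m := m) (by omega)
  push Not at hmin
  obtain ⟨B, hB, hJB, hB1, hpow⟩ := hmin J' hJ' hJJ' hJ'1
  rw [hm] at hno
  refine ⟨B, hB, hJJ'.trans hJB, hB1, hR.isRadical fun Q hQ hBQ hBQ2 => ?_⟩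
  have hle : J ≤ Q ^ (m + 1) := by
    refine hpow.trans ((Ideal.pow_right_mono hBQ2 m).trans ?_)
    rw [← pow_mul]
    exact Ideal.pow_le_pow_right (by omega)
  obtain ⟨E, hE, hEQ, hJE⟩ := exists_fg_le_pow hJ (m + 1) hle
  refine hno (J' ⊔ E) (Submodule.FG.sup hJ' hE) le_sup_left ?_
    (hJE.trans (Ideal.pow_right_mono le_sup_right _))
  exact fun htop => hQ.ne_top (top_le_iff.1 (htop ▸ sup_le (hJB.trans hBQ) hEQ))

theorem LocallyComparable.exists_local_generator (hR : LocallyComparable R) {J : Ideal R}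
    (hJ : J.FG) {Q : Ideal R} (hQ : Q.IsPrime) : ∃ x ∈ J, ∃ s ∉ Q, ∀ y ∈ J, x ∣ s * y := by
  induction J, hJ using Submodule.fg_induction with
  | singleton x =>
    refine ⟨x, Ideal.mem_span_singleton_self x, 1,
      fun h => hQ.ne_top ((Ideal.eq_top_iff_one _).2 h), fun y hy => ?_⟩
    rw [one_mul]
    exact Ideal.mem_span_singleton.1 hy
  | sup J₁ J₂ _ _ h₁ h₂ =>
    obtain ⟨x₁, hx₁, s₁, hs₁, hd₁⟩ := h₁
    obtain ⟨x₂, hx₂, s₂, hs₂, hd₂⟩ := h₂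
    have hs12 : s₁ * s₂ ∉ Q := fun hst => (hQ.mem_or_mem hst).elim hs₁ hs₂
    obtain ⟨s, hs, h | h⟩ := hR Q hQ x₁ x₂
    · refine ⟨x₁, Ideal.mem_sup_left hx₁, s * (s₁ * s₂),
        fun hst => (hQ.mem_or_mem hst).elim hs hs12, fun y hy => ?_⟩
      obtain ⟨y₁, hy₁, y₂, hy₂, rfl⟩ := Submodule.mem_sup.1 hy
      rw [show s * (s₁ * s₂) * (y₁ + y₂) = (s * s₂) * (s₁ * y₁) + s₁ * (s * (s₂ * y₂)) by ring]
      exact dvd_add ((hd₁ y₁ hy₁).mul_left _)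
        ((h.trans (mul_dvd_mul_left s (hd₂ y₂ hy₂))).mul_left _)
    · refine ⟨x₂, Ideal.mem_sup_right hx₂, s * (s₁ * s₂),
        fun hst => (hQ.mem_or_mem hst).elim hs hs12, fun y hy => ?_⟩
      obtain ⟨y₁, hy₁, y₂, hy₂, rfl⟩ := Submodule.mem_sup.1 hy
      rw [show s * (s₁ * s₂) * (y₁ + y₂) = s₂ * (s * (s₁ * y₁)) + (s * s₁) * (s₂ * y₂) by ring]
      exact dvd_add ((h.trans (mul_dvd_mul_left s (hd₁ y₁ hy₁))).mul_left _)
        ((hd₂ y₂ hy₂).mul_left _)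

/-- Nonzero finitely generated ideals are invertible, being locally principal. -/
theorem LocallyComparable.isUnit_coeIdeal [IsDomain R] (hR : LocallyComparable R)
    (K : Type*) [Field K] [Algebra R K] [IsFractionRing R K] {J : Ideal R} (hJ : J.FG)
    (hJ0 : J ≠ ⊥) : IsUnit (J : FractionalIdeal R⁰ K) := by
  have hJ0' : (J : FractionalIdeal R⁰ K) ≠ 0 := FractionalIdeal.coeIdeal_ne_zero.2 hJ0
  rw [← FractionalIdeal.mul_inv_cancel_iff_isUnit]
  refine le_antisymm (by
    rw [FractionalIdeal.inv_eq]; exact FractionalIdeal.mul_one_div_le_one) ?_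
  rw [FractionalIdeal.one_le]
  let A : Ideal R := Submodule.comap (Algebra.linearMap R K)
    (((J : FractionalIdeal R⁰ K) * (J : FractionalIdeal R⁰ K)⁻¹ : FractionalIdeal R⁰ K) :
      Submodule R K)
  suffices A = ⊤ by
    have h1 : (1 : R) ∈ A := this ▸ Submodule.mem_top
    rw [Submodule.mem_comap, Algebra.linearMap_apply, map_one] at h1
    exact h1
  by_contra hA
  obtain ⟨Q, hQ, hAQ⟩ := Ideal.exists_le_maximal _ hA
  obtain ⟨x, hx, s, hs, hd⟩ := hR.exists_local_generator hJ hQ.isPrime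
  have hx0 : x ≠ 0 := by
    rintro rfl
    refine hJ0 ((Submodule.eq_bot_iff _).2 fun y hy => ?_)
    refine (mul_eq_zero.1 (zero_dvd_iff.1 (hd y hy))).resolve_left ?_
    rintro rfl
    exact hs (zero_mem _)
  have hxK : algebraMap R K x ≠ 0 := by simpa using hx0
  refine hs (hAQ ?_)
  have hinv : algebraMap R K s / algebraMap R K x ∈ (J : FractionalIdeal R⁰ K)⁻¹ := by
    rw [FractionalIdeal.mem_inv_iff hJ0']
    intro y hy
    obtain ⟨y, hyJ, rfl⟩ := (FractionalIdeal.mem_coeIdeal _).1 hy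
    obtain ⟨z, hz⟩ := hd y hyJ
    rw [FractionalIdeal.mem_one_iff]
    refine ⟨z, ?_⟩
    have := congrArg (algebraMap R K) hz
    rw [map_mul, map_mul] at this
    field_simp
    rw [this, mul_comm]
  have := FractionalIdeal.mul_mem_mul (FractionalIdeal.mem_coeIdeal_of_mem R⁰ hx) hinv
  rw [mul_div_cancel₀ _ hxK] at this
  exact this

end LocallyComparable

/-! ### Splitting of fractions and extension of ideals to overrings -/

section SplitsFractions

theorem IsPruferDomain.splitsFractions {D : Type*} [CommRing D] [IsDomain D]
    (hD : IsPruferDomain D) (K : Type*) [Field K] [Algebra D K] [IsFractionRing D K] :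
    SplitsFractions D K := by
  intro t
  -- `N` is the sum of the ideal of denominators of `t` and of `t` times that ideal; it contains
  -- an element outside `Q` because `t` or its inverse lies in the localization at `Q`.
  let N : Ideal D :=
    { carrier := {r | ∃ c d e : D, t * algebraMap D K c = algebraMap D K e ∧
        algebraMap D K c + t * algebraMap D K d = algebraMap D K r}
      zero_mem' := ⟨0, 0, 0, by simp, by simp⟩
      add_mem' := by
        rintro r r' ⟨c, d, e, h, h'⟩ ⟨c', d', e', k, k'⟩
        refine ⟨c + c', d + d', e + e', ?_, ?_⟩ <;> simp only [map_add]
        · linear_combination h + k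
        · linear_combination h' + k'
      smul_mem' := by
        rintro a r ⟨c, d, e, h, h'⟩
        refine ⟨a * c, a * d, a * e, ?_, ?_⟩ <;> simp only [map_mul, smul_eq_mul]
        · linear_combination algebraMap D K a * h
        · linear_combination algebraMap D K a * h' }
  suffices N = ⊤ by
    obtain ⟨c, d, e, h, h'⟩ : (1 : D) ∈ N := this ▸ Submodule.mem_top
    exact ⟨c, d, e, h, by rw [h', map_one]⟩
  by_contra hN
  obtain ⟨Q, hQ, hNQ⟩ := Ideal.exists_le_maximal _ hN
  have := hQ.isPrime
  have := hD ⟨Q, hQ.isPrime⟩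
  obtain ⟨a, b, hb, rfl⟩ := IsFractionRing.div_surjective (A := D) t
  have hb0 : algebraMap D K b ≠ 0 := by simpa using nonZeroDivisors.ne_zero hb
  have key : ∀ x y : D, ∀ z : Localization.AtPrime Q,
      algebraMap D (Localization.AtPrime Q) x * z = algebraMap D (Localization.AtPrime Q) y →
      ∃ s ∉ Q, ∃ w, x * w = s * y := by
    intro x y z hz
    obtain ⟨⟨w, s⟩, hw⟩ := IsLocalization.surj Q.primeCompl z
    refine ⟨s, s.2, w, ?_⟩
    apply IsLocalization.injective (Localization.AtPrime Q) Q.primeCompl_le_nonZeroDivisors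
    rw [map_mul, map_mul, ← hz, ← hw]
    ring
  obtain ⟨z, hz | hz⟩ := ValuationRing.cond (algebraMap D (Localization.AtPrime Q) a)
    (algebraMap D (Localization.AtPrime Q) b)
  · obtain ⟨s, hs, w, hw⟩ := key a b z hz
    refine hs (hNQ ⟨0, w, 0, by simp, ?_⟩)
    have := congrArg (algebraMap D K) hw
    simp only [map_mul] at this
    field_simp
    simp only [map_zero]
    linear_combination this
  · obtain ⟨s, hs, w, hw⟩ := key b a z hz
    refine hs (hNQ ⟨s, 0, w, ?_, by simp⟩)
    have := congrArg (algebraMap D K) hw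
    simp only [map_mul] at this
    field_simp
    linear_combination -this

theorem SplitsFractions.locallyComparable {R K : Type*} [CommRing R] [IsDomain R] [Field K]
    [Algebra R K] [IsFractionRing R K] (h : SplitsFractions R K) : LocallyComparable R := by
  intro Q hQ a b
  have h1 : (1 : R) ∉ Q := fun h => hQ.ne_top ((Ideal.eq_top_iff_one _).2 h)
  by_cases hb : b = 0
  · exact ⟨1, h1, Or.inl (by simp [hb])⟩
  have hb0 : algebraMap R K b ≠ 0 := by simpa using hb
  have hinj := IsFractionRing.injective R K
  obtain ⟨c, d, e, hc, hd⟩ := h (algebraMap R K a / algebraMap R K b)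
  field_simp at hc hd
  by_cases hcQ : c ∈ Q
  · refine ⟨1 - c, fun h => h1 (by simpa using add_mem h hcQ), Or.inl ⟨d, hinj ?_⟩⟩
    simp only [map_mul, map_sub, map_one]
    linear_combination -hd
  · refine ⟨c, hcQ, Or.inr ⟨e, hinj ?_⟩⟩
    simp only [map_mul]
    linear_combination hc

variable {D : Type*} [CommRing D]

theorem SplitsFractions.subalgebra {K : Type*} [Field K] [Algebra D K]
    (h : SplitsFractions D K) (T : Subalgebra D K) : SplitsFractions D T := fun t => by
  obtain ⟨c, d, e, hc, hd⟩ := h t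
  exact ⟨c, d, e, Subtype.ext hc, Subtype.ext hd⟩

theorem SplitsFractions.of_subalgebra {K : Type*} [Field K] [Algebra D K]
    (h : SplitsFractions D K) (T : Subalgebra D K) : SplitsFractions T K := fun t => by
  obtain ⟨c, d, e, hc, hd⟩ := h t
  exact ⟨algebraMap D T c, algebraMap D T d, algebraMap D T e, hc, hd⟩

variable {T : Type*} [CommRing T] [Algebra D T]

/-- With `c + q * d = 1`, one has `q = q * c + q * (q * d)`, where `q * c` and `q * d`
come from `D`. -/
theorem SplitsFractions.mem_map (h : SplitsFractions D T) {I : Ideal T} {q : T} (hq : q ∈ I) :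
    ∃ J : Ideal D, J.FG ∧ J.map (algebraMap D T) ≤ I ∧ q ∈ J.map (algebraMap D T) := by
  obtain ⟨c, d, e, hc, hd⟩ := h q
  have hf : q * algebraMap D T d = algebraMap D T (1 - c) := by
    rw [map_sub, map_one]
    linear_combination hd
  refine ⟨Ideal.span {e} ⊔ Ideal.span {1 - c}, Submodule.FG.sup (Submodule.fg_span_singleton _)
    (Submodule.fg_span_singleton _), ?_, ?_⟩
  · rw [Ideal.map_sup, Ideal.map_span, Ideal.map_span, Set.image_singleton, Set.image_singleton,
      ← hc, ← hf]
    exact sup_le ((Ideal.span_singleton_le_iff_mem _).2 (Ideal.mul_mem_right _ _ hq))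
      ((Ideal.span_singleton_le_iff_mem _).2 (Ideal.mul_mem_right _ _ hq))
  · have : q = algebraMap D T e + q * algebraMap D T (1 - c) := by
      rw [← hc, map_sub, map_one]
      ring
    rw [this]
    exact add_mem
      (Ideal.mem_map_of_mem _ (Ideal.mem_sup_left (Ideal.mem_span_singleton_self e)))
      (Ideal.mul_mem_left _ _ (Ideal.mem_map_of_mem _
        (Ideal.mem_sup_right (Ideal.mem_span_singleton_self _))))

theorem SplitsFractions.exists_fg_map_eq (h : SplitsFractions D T) {I : Ideal T} (hI : I.FG) :
    ∃ J : Ideal D, J.FG ∧ J.map (algebraMap D T) = I := by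
  induction I, hI using Submodule.fg_induction with
  | singleton x =>
    obtain ⟨J, hJ, hle, hx⟩ := h.mem_map (Ideal.mem_span_singleton_self x)
    exact ⟨J, hJ, le_antisymm hle ((Ideal.span_singleton_le_iff_mem _).2 hx)⟩
  | sup I₁ I₂ _ _ h₁ h₂ =>
    obtain ⟨J₁, hJ₁, rfl⟩ := h₁
    obtain ⟨J₂, hJ₂, rfl⟩ := h₂
    exact ⟨J₁ ⊔ J₂, Submodule.FG.sup hJ₁ hJ₂, Ideal.map_sup _ _ _⟩

theorem SplitsFractions.map_comap (h : SplitsFractions D T) (I : Ideal T) :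
    (I.comap (algebraMap D T)).map (algebraMap D T) = I := by
  refine le_antisymm Ideal.map_comap_le fun q hq => ?_
  obtain ⟨J, -, hle, hq⟩ := h.mem_map hq
  exact Ideal.map_mono (Ideal.map_le_iff_le_comap.1 hle) hq

/-- If `PT ≠ T`, then `T` is contained in the localization of `D` at `P`. -/
theorem SplitsFractions.exists_notMem_mul_mem_range (h : SplitsFractions D T) {P : Ideal D}
    (hP : P.map (algebraMap D T) ≠ ⊤) (t : T) :
    ∃ s ∉ P, ∃ r : D, algebraMap D T s * t = algebraMap D T r := by
  obtain ⟨c, d, e, hc, hd⟩ := h t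
  by_cases hcP : c ∈ P
  · refine ⟨d, fun hdP => hP ((Ideal.eq_top_iff_one _).2 ?_), 1 - c, ?_⟩
    · rw [← hd]
      exact add_mem (Ideal.mem_map_of_mem _ hcP)
        (Ideal.mul_mem_left _ _ (Ideal.mem_map_of_mem _ hdP))
    · rw [map_sub, map_one]
      linear_combination hd
  · exact ⟨c, hcP, e, by rw [← hc, mul_comm]⟩

theorem SplitsFractions.exists_mul_mem_of_mem_map (h : SplitsFractions D T)
    {P : Ideal D} [P.IsPrime] (hP : P.map (algebraMap D T) ≠ ⊤) (I : Ideal D) {t : T}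
    (ht : t ∈ I.map (algebraMap D T)) :
    ∃ s ∉ P, ∃ r ∈ I, algebraMap D T s * t = algebraMap D T r := by
  have hone : (1 : D) ∉ P := fun h1 => Ideal.IsPrime.ne_top' ((Ideal.eq_top_iff_one _).2 h1)
  induction ht using Submodule.span_induction with
  | mem x hx =>
    obtain ⟨r, hr, rfl⟩ := hx
    exact ⟨1, hone, r, hr, by simp⟩
  | zero => exact ⟨1, hone, 0, zero_mem _, by simp⟩
  | add x y _ _ hx hy =>
    obtain ⟨s, hs, r, hr, hx⟩ := hx
    obtain ⟨s', hs', r', hr', hy⟩ := hy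
    refine ⟨s * s', fun hss => (Ideal.IsPrime.mem_or_mem ‹_› hss).elim hs hs', s' * r + s * r',
      add_mem (Ideal.mul_mem_left _ _ hr) (Ideal.mul_mem_left _ _ hr'), ?_⟩
    simp only [map_mul, map_add, ← hx, ← hy]
    ring
  | smul a x _ hx =>
    obtain ⟨s, hs, r, hr, hx⟩ := hx
    obtain ⟨s', hs', r', ha⟩ := h.exists_notMem_mul_mem_range hP a
    refine ⟨s * s', fun hss => (Ideal.IsPrime.mem_or_mem ‹_› hss).elim hs hs', r' * r,
      Ideal.mul_mem_left _ _ hr, ?_⟩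
    simp only [map_mul, smul_eq_mul, ← hx, ← ha]
    ring

theorem SplitsFractions.map_sq_ne (h : SplitsFractions D T)
    (hinj : Function.Injective (algebraMap D T)) {P : Ideal D} (hPmax : P.IsMaximal)
    (hP : P.map (algebraMap D T) ≠ ⊤) (hP2 : P ^ 2 ≠ P) :
    P.map (algebraMap D T) ^ 2 ≠ P.map (algebraMap D T) := by
  intro heq
  refine hP2 (le_antisymm (Ideal.pow_le_self two_ne_zero) fun x hx => ?_)
  have := hPmax.isPrime
  have hx' := Ideal.mem_map_of_mem (algebraMap D T) hx
  rw [← heq, ← Ideal.map_pow] at hx'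
  obtain ⟨s, hs, r, hr, hsr⟩ := h.exists_mul_mem_of_mem_map hP _ hx'
  rw [← map_mul] at hsr
  exact mem_sq_of_mul_mem hPmax hs (hinj hsr ▸ hr)

theorem comap_eq_of_map_le {P : Ideal D} (hP : P.IsMaximal) {Q : Ideal T} (hQ : Q ≠ ⊤)
    (h : P.map (algebraMap D T) ≤ Q) : Q.comap (algebraMap D T) = P :=
  (hP.eq_of_le (Ideal.comap_ne_top _ hQ) (Ideal.map_le_iff_le_comap.1 h)).symm

theorem SplitsFractions.isMaximal_map
    (h : SplitsFractions D T) {P : Ideal D} (hP : P.IsMaximal)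
    (hPT : P.map (algebraMap D T) ≠ ⊤) : (P.map (algebraMap D T)).IsMaximal := by
  obtain ⟨Q, hQ, hle⟩ := Ideal.exists_le_maximal _ hPT
  have := comap_eq_of_map_le hP hQ.ne_top hle
  rwa [← this, h.map_comap]

end SplitsFractions

/-! ### The overring of a set of primes -/

section Overring

variable {D : Type u} [CommRing D] [IsDomain D]
variable (K : Type v) [Field K] [Algebra D K] [IsFractionRing D K]

theorem mem_locAt_of_mul_mem {P : PrimeSpectrum D} {s r : D} (hs : s ∉ P.asIdeal) {x : K}
    (h : x * algebraMap D K s = algebraMap D K r) : x ∈ locAt K P := by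
  refine ⟨r, s, hs, ?_⟩
  have : algebraMap D K s ≠ 0 := by
    rw [Ne, FaithfulSMul.algebraMap_eq_zero_iff]
    rintro rfl
    exact hs (zero_mem _)
  rw [← h, mul_inv_cancel_right₀ this]

theorem le_of_mem_supp {I : Ideal D} {Q : PrimeSpectrum D}
    (h : Q ∈ supp K (I : FractionalIdeal D⁰ K)) : I ≤ Q.asIdeal := by
  by_contra hle
  obtain ⟨x, hx, hxQ⟩ := SetLike.not_le_iff_exists.1 hle
  have hx0 : algebraMap D K x ≠ 0 := by
    rw [Ne, FaithfulSMul.algebraMap_eq_zero_iff]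
    rintro rfl
    exact hxQ (zero_mem _)
  refine h (le_antisymm ?_ fun y hy => ?_)
  · rw [Submodule.mul_le]
    intro a ha b hb
    obtain ⟨a, -, rfl⟩ := (FractionalIdeal.mem_coeIdeal _).1 ha
    exact (locAt K Q).mul_mem ((locAt K Q).algebraMap_mem a) hb
  · have hinv : (algebraMap D K x)⁻¹ ∈ locAt K Q :=
      mem_locAt_of_mul_mem K hxQ (r := 1) (by rw [inv_mul_cancel₀ hx0, map_one])
    rw [← mul_inv_cancel_left₀ hx0 y]
    exact Submodule.mul_mem_mul (FractionalIdeal.mem_coeIdeal_of_mem D⁰ hx)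
      ((locAt K Q).mul_mem hinv hy)

theorem mem_overringOf {X C : Set (PrimeSpectrum D)} {x : K} :
    x ∈ overringOf K X C ↔ ∀ P ∈ C ∪ Xᶜ, x ∈ locAt K P := by
  simp only [overringOf, Algebra.mem_iInf]

/-- The inverse of `J` is contained in every `D_P` with `J ⊄ P`, so it lies in the overring, where
`J` therefore generates the unit ideal. -/
theorem map_overringOf_eq_top {X C : Set (PrimeSpectrum D)} {J : Ideal D}
    (hJ : IsUnit (J : FractionalIdeal D⁰ K))
    (h : ∀ P : PrimeSpectrum D, J ≤ P.asIdeal → P ∈ X ∧ P ∉ C) :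
    J.map (algebraMap D (overringOf K X C)) = ⊤ := by
  have hJ0 : (J : FractionalIdeal D⁰ K) ≠ 0 := hJ.ne_zero
  have hinv : ∀ z ∈ (J : FractionalIdeal D⁰ K)⁻¹, z ∈ overringOf K X C := by
    intro z hz
    rw [mem_overringOf]
    intro P hP
    obtain ⟨j, hj, hjP⟩ := SetLike.not_le_iff_exists.1 (fun hle : J ≤ P.asIdeal =>
      hP.elim (h P hle).2 (fun hPX => hPX (h P hle).1))
    obtain ⟨r, hr⟩ := (FractionalIdeal.mem_one_iff _).1 ((FractionalIdeal.mem_inv_iff hJ0).1 hz _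
      (FractionalIdeal.mem_coeIdeal_of_mem D⁰ hj))
    exact mem_locAt_of_mul_mem K hjP hr.symm
  have key : ∀ x ∈ (J : FractionalIdeal D⁰ K) * (J : FractionalIdeal D⁰ K)⁻¹,
      ∃ y ∈ J.map (algebraMap D (overringOf K X C)), (y : K) = x := by
    intro x hx
    refine FractionalIdeal.mul_induction_on hx (fun i hi z hz => ?_) fun x y hx hy => ?_
    · obtain ⟨i, hiJ, rfl⟩ := (FractionalIdeal.mem_coeIdeal _).1 hi
      exact ⟨algebraMap D _ i * ⟨z, hinv z hz⟩,
        Ideal.mul_mem_right _ _ (Ideal.mem_map_of_mem _ hiJ), rfl⟩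
    · obtain ⟨a, ha, rfl⟩ := hx
      obtain ⟨b, hb, rfl⟩ := hy
      exact ⟨a + b, add_mem ha hb, rfl⟩
  rw [(FractionalIdeal.mul_inv_cancel_iff_isUnit K).2 hJ] at key
  obtain ⟨y, hy, hy1⟩ := key 1 (FractionalIdeal.one_mem_one _)
  rw [Ideal.eq_top_iff_one]
  rwa [show y = 1 from Subtype.ext hy1] at hy

end Overring

/-! ### Open sets of the inverse topology -/

section InverseOpen

variable {D : Type u} [CommRing D]

/-- Openness in the inverse topology of the spectrum, whose basic open sets are the zero loci of
finitely generated ideals. -/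
def IsInverseOpen (U : Set (PrimeSpectrum D)) : Prop :=
  ∀ P ∈ U, ∃ J : Ideal D, J.FG ∧ J ≤ P.asIdeal ∧ PrimeSpectrum.zeroLocus (J : Set D) ⊆ U

theorem IsSplittingSet.isInverseOpen {X : Set (PrimeSpectrum D)} (hX : IsSplittingSet X) :
    IsInverseOpen X := by
  intro P hP
  obtain ⟨t, ht⟩ := hX.2.elim_finite_subcover
    (fun f : P.asIdeal => (PrimeSpectrum.basicOpen (f : D) : Set (PrimeSpectrum D)))
    (fun f => (PrimeSpectrum.basicOpen (f : D)).isOpen) (by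
      intro Q hQ
      obtain ⟨f, hf, hfQ⟩ := SetLike.not_le_iff_exists.1 (fun hle => hQ (hX.1 P hP Q hle))
      exact Set.mem_iUnion.2 ⟨⟨f, hf⟩, hfQ⟩)
  refine ⟨Ideal.span ((fun f : P.asIdeal => (f : D)) '' t),
    Submodule.fg_span (t.finite_toSet.image _), ?_, ?_⟩
  · rw [Ideal.span_le]
    rintro _ ⟨f, -, rfl⟩
    exact f.2
  · intro Q hQ
    by_contra hQX
    obtain ⟨f, hf, hfQ⟩ := Set.mem_iUnion₂.1 (ht hQX)
    exact hfQ (hQ (Ideal.subset_span ⟨f, hf, rfl⟩))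

theorem IsInverseOpen.iUnion {ι : Sort*} {U : ι → Set (PrimeSpectrum D)}
    (hU : ∀ i, IsInverseOpen (U i)) : IsInverseOpen (⋃ i, U i) := by
  intro P hP
  obtain ⟨i, hi⟩ := Set.mem_iUnion.1 hP
  obtain ⟨J, hJ, hJP, hJU⟩ := hU i P hi
  exact ⟨J, hJ, hJP, hJU.trans (Set.subset_iUnion U i)⟩

theorem isInverseOpen_empty : IsInverseOpen (∅ : Set (PrimeSpectrum D)) := fun _ h => h.elim

theorem ne_bot_of_zeroLocus_subset [IsDomain D] {X : Set (PrimeSpectrum D)}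
    (hX : ∀ P ∈ X, P.asIdeal ^ 2 ≠ P.asIdeal) {J : Ideal D}
    (hJ : PrimeSpectrum.zeroLocus (J : Set D) ⊆ X) : J ≠ ⊥ := by
  rintro rfl
  refine hX ⟨⊥, Ideal.isPrime_bot⟩ (hJ (fun x hx => hx)) ?_
  simp [pow_two]

end InverseOpen

/-! ### One step of the critical sequence -/

section CriticalStep

variable {D : Type u} [CommRing D] [IsDomain D]
variable {K : Type v} [Field K] [Algebra D K] [IsFractionRing D K]
variable {X C : Set (PrimeSpectrum D)}

theorem map_overringOf_ne_top {P : PrimeSpectrum D} (hP : P ∈ C) :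
    P.asIdeal.map (algebraMap D (overringOf K X C)) ≠ ⊤ := by
  intro htop
  have hle : overringOf K X C ≤ locAt K P := fun x hx => mem_overringOf K |>.1 hx P (Or.inl hP)
  have : IsLocalization.AtPrime (locAt K P) P.asIdeal :=
    Localization.subalgebra.isLocalization_ofField K P.asIdeal.primeCompl
      P.asIdeal.primeCompl_le_nonZeroDivisors
  have h1 : P.asIdeal.map (algebraMap D (locAt K P)) = ⊤ := by
    have := congrArg (Ideal.map (Subalgebra.inclusion hle).toRingHom) htop
    rw [Ideal.map_map, Ideal.map_top] at this
    exact this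
  exact (IsLocalization.map_algebraMap_ne_top_iff_disjoint P.asIdeal.primeCompl (locAt K P)
    P.asIdeal).2 (Set.disjoint_left.2 fun _ h => h) h1

/-- When `X \ C` is open in the inverse topology, the primes of `X` that survive in the overring are
exactly those of `C`: the others contain an invertible ideal that becomes the unit ideal. -/
theorem mem_of_map_overringOf_ne_top (hD : SplitsFractions D K)
    (hX : ∀ P ∈ X, P.asIdeal ^ 2 ≠ P.asIdeal) (hC : IsInverseOpen (X \ C)) {P : PrimeSpectrum D}
    (hP : P ∈ X) (h : P.asIdeal.map (algebraMap D (overringOf K X C)) ≠ ⊤) : P ∈ C := by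
  by_contra hPC
  obtain ⟨J, hJ, hJP, hJX⟩ := hC P ⟨hP, hPC⟩
  have hJ0 : J ≠ ⊥ := ne_bot_of_zeroLocus_subset hX (hJX.trans Set.sdiff_subset)
  have := map_overringOf_eq_top K (hD.locallyComparable.isUnit_coeIdeal K hJ hJ0)
    (X := X) (C := C) (fun P' hP' => hJX hP')
  exact h (top_le_iff.1 (this ▸ Ideal.map_mono hJP))

theorem critStep_subset (hD : SplitsFractions D K)
    (hX : ∀ P ∈ X, P.asIdeal ^ 2 ≠ P.asIdeal) (hC : IsInverseOpen (X \ C)) :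
    critStep K X C ⊆ C := by
  rintro P ⟨hP, Q, -, hQ⟩
  exact mem_of_map_overringOf_ne_top hD hX hC hP (hQ ▸ Q.2.ne_top)

/-- A radical ideal `I` of the overring witnessing that `PT` is not critical is the extension of a
finitely generated ideal `J` of `D`, and it witnesses the same for all primes containing `J`. -/
theorem isInverseOpen_diff_critStep (hD : SplitsFractions D K)
    (hX : IsInverseOpen X) (hX2 : ∀ P ∈ X, P.asIdeal ^ 2 ≠ P.asIdeal) (hmax : X ⊆ maxSpec D)
    (hC : IsInverseOpen (X \ C)) : IsInverseOpen (X \ critStep K X C) := by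
  rintro P ⟨hP, hPC⟩
  have hT := hD.subalgebra (overringOf K X C)
  by_cases hPC' : P ∈ C
  · have hne := map_overringOf_ne_top (K := K) (X := X) hPC'
    have hmaxP := hT.isMaximal_map (hmax hP) hne
    let Q : PrimeSpectrum (overringOf K X C) := ⟨_, hmaxP.isPrime⟩
    have hQ : Q ∉ Crit K (extendSet X (overringOf K X C)) := fun h => hPC ⟨hP, Q, h, rfl⟩
    obtain ⟨I, hrad, hI, hIQ⟩ : ∃ I : Ideal (overringOf K X C), I.IsRadical ∧
        (I : FractionalIdeal (overringOf K X C)⁰ K) ∈ InvX K (extendSet X (overringOf K X C)) ∧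
        I ≤ Q.asIdeal := by
      by_contra hno
      exact hQ ⟨⟨P, hP, rfl⟩, hno⟩
    obtain ⟨J, hJ, hJI⟩ := hT.exists_fg_map_eq
      (Ideal.fg_of_isUnit (IsFractionRing.injective (overringOf K X C) K) I hI.1)
    obtain ⟨J', hJ', hJP', hJX'⟩ := hX P hP
    refine ⟨J ⊔ J', Submodule.FG.sup hJ hJ', sup_le ?_ hJP', fun P' hP' =>
      ⟨hJX' ((le_sup_right : J' ≤ J ⊔ J').trans hP'), ?_⟩⟩
    · rw [← comap_eq_of_map_le (hmax hP) hmaxP.ne_top le_rfl, ← Ideal.map_le_iff_le_comap, hJI]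
      exact hIQ
    · rintro ⟨-, Q', hQ', hQP'⟩
      refine hQ'.2 ⟨I, hrad, hI, ?_⟩
      rw [hQP', ← hJI]
      exact Ideal.map_mono ((le_sup_left : J ≤ J ⊔ J').trans hP')
  · obtain ⟨J, hJ, hJP, hJX⟩ := hC P ⟨hP, hPC'⟩
    exact ⟨J, hJ, hJP, hJX.trans (Set.sdiff_subset_sdiff_right (critStep_subset hD hX2 hC))⟩

/-- A nonempty `C` is never a fixed point: the overring contains a finitely generated radical ideal
with support in `XT`, and the maximal ideals above it come from primes in `C` that are not
critical. -/
theorem critStep_ne_self (hD : SplitsFractions D K)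
    (hX : IsInverseOpen X) (hX2 : ∀ P ∈ X, P.asIdeal ^ 2 ≠ P.asIdeal) (hmax : X ⊆ maxSpec D)
    (hC : IsInverseOpen (X \ C)) (hCX : C ⊆ X) (hne : C.Nonempty) : critStep K X C ≠ C := by
  intro heq
  obtain ⟨P, hP⟩ := hne
  obtain ⟨J, hJ, hJP, hJX⟩ := hX P (hCX hP)
  have hT := hD.subalgebra (overringOf K X C)
  have hinj : Function.Injective (algebraMap D (overringOf K X C)) :=
    FaithfulSMul.algebraMap_injective _ _
  have hPT := map_overringOf_ne_top (K := K) (X := X) hP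
  have hLC := (hD.of_subalgebra (overringOf K X C)).locallyComparable
  have hext : ∀ Q : PrimeSpectrum (overringOf K X C),
      J.map (algebraMap D (overringOf K X C)) ≤ Q.asIdeal → ∃ P' ∈ X,
        Q.asIdeal = P'.asIdeal.map (algebraMap D (overringOf K X C)) := by
    intro Q hQ
    refine ⟨PrimeSpectrum.comap (algebraMap D _) Q,
      hJX (Ideal.map_le_iff_le_comap.1 hQ), (hT.map_comap _).symm⟩
  obtain ⟨I, hI, hJI, hI1, hrad⟩ := hLC.exists_fg_isRadical (hJ.map (algebraMap D _))
    (fun htop => hPT (top_le_iff.1 (htop ▸ Ideal.map_mono hJP))) (fun p hp hJp => by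
      obtain ⟨P', hP', hpP'⟩ := hext ⟨p, hp⟩ hJp
      obtain rfl : p = _ := hpP'
      exact ⟨hT.isMaximal_map (hmax hP') hp.ne_top,
        hT.map_sq_ne hinj (hmax hP') hp.ne_top (hX2 P' hP')⟩)
  have hI0 : I ≠ ⊥ := by
    rintro rfl
    exact ne_bot_of_zeroLocus_subset hX2 hJX
      ((Ideal.map_eq_bot_iff_of_injective hinj).1 (le_bot_iff.1 hJI))
  obtain ⟨Q, hQ, hIQ⟩ := Ideal.exists_le_maximal _ hI1
  obtain ⟨P', hP', hQP'⟩ := hext ⟨Q, hQ.isPrime⟩ (hJI.trans hIQ)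
  have hP'C : P' ∈ C := mem_of_map_overringOf_ne_top hD hX2 hC hP' (hQP' ▸ hQ.ne_top)
  rw [← heq] at hP'C
  obtain ⟨-, Q', hQ', hQP''⟩ := hP'C
  refine hQ'.2 ⟨I, hrad, ⟨hLC.isUnit_coeIdeal K hI hI0, fun Q'' hQ'' =>
    hext Q'' (hJI.trans (le_of_mem_supp K hQ''))⟩, ?_⟩
  rw [hQP'', ← hQP']
  exact hIQ

end CriticalStep

/-! ### The transfinite sequence -/

section Sequence

variable {D : Type u} [CommRing D] [IsDomain D]
variable {K : Type v} [Field K] [Algebra D K] [IsFractionRing D K]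
variable {X : Set (PrimeSpectrum D)}

theorem isInverseOpen_diff_critSeq (hD : SplitsFractions D K)
    (hX : IsInverseOpen X) (hX2 : ∀ P ∈ X, P.asIdeal ^ 2 ≠ P.asIdeal) (hmax : X ⊆ maxSpec D)
    (α : Ordinal.{u}) : IsInverseOpen (X \ critSeq K X α) := by
  induction α using Ordinal.limitRecOn with
  | zero => simpa [critSeq_zero] using isInverseOpen_empty
  | add_one γ ih =>
    rw [critSeq_add_one]
    exact isInverseOpen_diff_critStep hD hX hX2 hmax ih
  | limit α hα ih =>
    simp only [critSeq_limit K X α hα, Set.sdiff_iInter]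
    exact IsInverseOpen.iUnion fun γ => IsInverseOpen.iUnion fun hγ => ih γ hγ

theorem critSeq_antitone (hD : SplitsFractions D K)
    (hX : IsInverseOpen X) (hX2 : ∀ P ∈ X, P.asIdeal ^ 2 ≠ P.asIdeal) (hmax : X ⊆ maxSpec D) :
    Antitone (critSeq K X : Ordinal.{u} → Set (PrimeSpectrum D)) := by
  intro γ α
  induction α using Ordinal.limitRecOn with
  | zero => exact fun h => by rw [nonpos_iff_eq_zero.1 h]
  | add_one α ih =>
    intro h
    rcases h.eq_or_lt with rfl | h
    · exact le_rfl
    · refine le_trans ?_ (ih (Order.lt_add_one_iff.1 h))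
      rw [critSeq_add_one]
      exact critStep_subset hD hX2 (isInverseOpen_diff_critSeq hD hX hX2 hmax α)
  | limit α hα _ =>
    intro h
    rcases h.eq_or_lt with rfl | h
    · exact le_rfl
    · rw [critSeq_limit K X α hα]
      exact Set.iInter₂_subset γ h

/-- A sequence of nonempty sets would decrease strictly at each step and so embed the ordinals into
the spectrum of `D`. -/
theorem exists_critSeq_eq_empty (hD : SplitsFractions D K)
    (hX : IsInverseOpen X) (hX2 : ∀ P ∈ X, P.asIdeal ^ 2 ≠ P.asIdeal) (hmax : X ⊆ maxSpec D) :
    ∃ β : Ordinal.{u}, critSeq K X β = ∅ := by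
  by_contra! hne
  have hanti := critSeq_antitone hD hX hX2 hmax
  have hdrop : ∀ γ : Ordinal.{u}, ∃ P ∈ critSeq K X γ, P ∉ critSeq K X (γ + 1) := by
    intro γ
    by_contra! hsub
    refine critStep_ne_self (C := critSeq K X γ) hD hX hX2 hmax
      (isInverseOpen_diff_critSeq hD hX hX2 hmax γ) ?_ (hne γ) ?_
    · simpa [critSeq_zero] using hanti (zero_le (a := γ))
    · refine (critStep_subset hD hX2 (isInverseOpen_diff_critSeq hD hX hX2 hmax γ)).antisymm ?_
      have : critStep K X (critSeq K X γ) = critSeq K X (γ + 1) := (critSeq_add_one K X γ).symm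
      rw [this]
      exact hsub
  choose f hf hf' using hdrop
  refine not_injective_of_ordinal.{u, u} f
    (Function.Injective.of_lt_imp_ne fun γ δ hlt heq => hf' γ ?_)
  exact hanti (Order.add_one_le_of_lt hlt) (heq ▸ hf δ)

end Sequence

end CriticalSequence

theorem mainTheorem5 {D : Type u} [CommRing D] [IsDomain D]
    (K : Type v) [Field K] [Algebra D K] [IsFractionRing D K]
    (hD : CriticalSequence.IsPruferDomain D)
    (X : Set (PrimeSpectrum D))
    (hX : CriticalSequence.IsDiscreteSplittingSet X)
    (hmax : X ⊆ CriticalSequence.maxSpec D) :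
    (∃ β : Ordinal.{u}, CriticalSequence.critSeq K X β = ∅) ∧
      IsLeast {α : Ordinal.{u} | CriticalSequence.critSeq K X α = ∅}
        (CriticalSequence.spRank K X) := by
  have h := CriticalSequence.exists_critSeq_eq_empty (hD.splitsFractions K) hX.1.isInverseOpen
    hX.2 hmax
  exact ⟨h, csInf_mem h, fun _ hα => csInf_le' hα⟩
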